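/- For an integer $m\ge 0$ let $$g(x)=g_m(x)=\sum_{k=0}^{m}\varepsilon_k\cos(kx),$$ where $\varepsilon_0,\dots,\varepsilon_m$ are independent random variables with $\mathbb P(\varepsilon_k=0)=\mathbb P(\varepsilon_k=1)=1/2$. For a function $g:\mathbb R\to\mathbb R$ let $$\mathcal E(g)=\{x\in(0,\pi] : |g(x)-1/2|<s(x)\},\qquad s(x)=\frac{1}{2\sin(x/2)},$$ and let $|\mathcal E(g)|$ denote its Lebesgue measure. Then $$\mathbb E\,|\mathcal E(g_m)|=\Theta\!\left(\frac{\log m}{\sqrt m}\right);$$ that is, there are absolute constants $c,C>0$ such that, for every integer $m\ge 2$, $|\mathcal E(g_m)|$ is an integrable random variable and $$c\,\frac{\log m}{\sqrt m}\;\le\;\mathbb E\,|\mathcal E(g_m)|\;\le\;C\,\frac{\log m}{\sqrt m}.$$ -/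

import Mathlib

open MeasureTheory ProbabilityTheory

/-- The envelope function `s(x) = (2 sin(x/2))⁻¹`; its denominator is positive on `(0, π]`. -/
noncomputable def envelopeFn (x : ℝ) : ℝ := (2 * Real.sin (x / 2))⁻¹

/-- The set `𝓔(g) = {x ∈ (0, π] : |g(x) - 1/2| < s(x)}`. -/
def envelopeSet (g : ℝ → ℝ) : Set ℝ :=
  {x | x ∈ Set.Ioc 0 Real.pi ∧ |g x - 1 / 2| < envelopeFn x}

/-- The cosine polynomial `x ↦ ∑_{k=0}^{m} a_k cos(kx)`. -/
noncomputable def cosPoly {m : ℕ} (a : Fin (m + 1) → ℝ) (x : ℝ) : ℝ :=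
  ∑ k : Fin (m + 1), a k * Real.cos ((k : ℕ) * x)

/-- The random coefficients `ε₀, …, ε_m` are mutually independent with
`ℙ(ε_k = 0) = ℙ(ε_k = 1) = 1/2`. -/
structure IsFairBernoulliFamily {Ω : Type*} [MeasurableSpace Ω] (μ : Measure Ω) {m : ℕ}
    (ε : Fin (m + 1) → Ω → ℝ) : Prop where
  measurable : ∀ k, Measurable (ε k)
  indep : iIndepFun ε μ
  prob_zero : ∀ k, μ {ω | ε k ω = 0} = 1 / 2
  prob_one : ∀ k, μ {ω | ε k ω = 1} = 1 / 2

/-! By Fubini, the expectation is `2⁻⁽ᵐ⁺¹⁾` times the integral over `(0, π]` of `patternCount m x`,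
so everything rests on the probability at fixed `x` that the random sum lies within the envelope.
That probability has order `1 / (x √m)` on a range of `x` whose logarithmic length is of order `log
m`.

Upper bound: a positive proportion of the numbers `|cos (k x)|` is at least `1/2`, so the
Littlewood–Offord bound gives `O(s(x) / √m)` with `s(x) ≤ 2/x` (`patternCount_le`). This is
integrated over `x > 1/√m`; the rest has measure at most `1/√m`.

Lower bound: the mean uses up only about half of the envelope (`abs_half_sum_cos_sub_le`).
Coefficients of indices `2j` and `2j+1` differ by at most `x`, so the centered sum is a sum of two
independent copies of one variable plus a small error. By symmetry the sum of the copies is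
distributed as their difference, which is small often enough by pigeonhole
(`le_card_centeredSum_pair`). This works for `m^(-1/2) < x ≤ m^(-1/3)` and large `m`; for the
remaining `m` the zero pattern suffices. -/

/-! ### Reduction of the expectation to counting patterns. -/

/-- The real number `0` or `1` encoded by a Boolean. -/
def boolVal (b : Bool) : ℝ := if b then 1 else 0

/-- A fair Bernoulli family takes each `0`-`1` pattern with probability `2⁻ᵐ⁻¹`. -/
lemma IsFairBernoulliFamily.real_pattern {Ω : Type*} [MeasurableSpace Ω] {μ : Measure Ω}
    {m : ℕ} {ε : Fin (m + 1) → Ω → ℝ} (h : IsFairBernoulliFamily μ ε) (η : Fin (m + 1) → Bool) :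
    μ.real {ω | ∀ k, ε k ω = boolVal (η k)} = (1 / 2) ^ (m + 1) := by
  have h1 := h.indep.measure_inter_preimage_eq_mul Finset.univ
    (sets := fun k => {boolVal (η k)}) (fun i _ => measurableSet_singleton _)
  have h2 : {ω | ∀ k, ε k ω = boolVal (η k)} =
      ⋂ i ∈ (Finset.univ : Finset (Fin (m + 1))), ε i ⁻¹' {boolVal (η i)} := by
    ext ω; simp
  have h3 : ∀ i, μ (ε i ⁻¹' {boolVal (η i)}) = 1 / 2 := by
    intro i
    cases hb : η i
    · simpa [boolVal, Set.preimage] using h.prob_zero i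
    · simpa [boolVal, Set.preimage] using h.prob_one i
  rw [measureReal_def, h2, h1, Finset.prod_congr rfl (fun i _ => h3 i)]
  simp

lemma IsFairBernoulliFamily.ae_pattern {Ω : Type*} [MeasurableSpace Ω] {μ : Measure Ω}
    [IsProbabilityMeasure μ]
    {m : ℕ} {ε : Fin (m + 1) → Ω → ℝ} (h : IsFairBernoulliFamily μ ε) :
    ∀ᵐ ω ∂μ, ∃ η : Fin (m + 1) → Bool, ∀ k, ε k ω = boolVal (η k) := by
  have h1 : ∀ k, ∀ᵐ ω ∂μ, ε k ω = 0 ∨ ε k ω = 1 := by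
    intro k
    have hm0 : MeasurableSet {ω | ε k ω = 0} := h.measurable k (measurableSet_singleton 0)
    have hm1 : MeasurableSet {ω | ε k ω = 1} := h.measurable k (measurableSet_singleton 1)
    have hd : Disjoint {ω | ε k ω = 0} {ω | ε k ω = 1} := by
      rw [Set.disjoint_left]
      intro ω h0 h1
      simp only [Set.mem_ofPred_eq] at h0 h1
      rw [h0] at h1
      exact zero_ne_one h1
    have := measure_union (μ := μ) hd hm1
    rw [h.prob_zero, h.prob_one, ENNReal.add_halves] at this
    exact (mem_ae_iff_prob_eq_one (hm0.union hm1)).2 this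
  filter_upwards [ae_all_iff.2 h1] with ω hω
  refine ⟨fun k => decide (ε k ω = 1), fun k => ?_⟩
  rcases hω k with h0 | h0 <;> simp [boolVal, h0]

/-- Every functional of a fair Bernoulli family is integrable, and its expectation is the average
over all patterns. -/
lemma IsFairBernoulliFamily.integrable_and_integral {Ω : Type*} [MeasurableSpace Ω] {μ : Measure Ω}
    [IsProbabilityMeasure μ]
    {m : ℕ} {ε : Fin (m + 1) → Ω → ℝ} (h : IsFairBernoulliFamily μ ε)
    (F : (Fin (m + 1) → ℝ) → ℝ) :
    Integrable (fun ω => F fun k => ε k ω) μ ∧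
    ∫ ω, F (fun k => ε k ω) ∂μ =
      (1 / 2) ^ (m + 1) * ∑ η : Fin (m + 1) → Bool, F (fun k => boolVal (η k)) := by
  set S : (Fin (m + 1) → Bool) → Set Ω := fun η => {ω | ∀ k, ε k ω = boolVal (η k)} with hS
  have hmeas : ∀ η, MeasurableSet (S η) := by
    intro η
    have : S η = ⋂ k, ε k ⁻¹' {boolVal (η k)} := by ext ω; simp [hS]
    rw [this]
    exact MeasurableSet.iInter fun k => h.measurable k (measurableSet_singleton _)
  have hinj : ∀ a b : Bool, boolVal a = boolVal b → a = b := by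
    intro a b; cases a <;> cases b <;> simp [boolVal]
  -- `F` need not be measurable: almost surely the composition equals a finite combination of
  -- indicators of pattern events.
  have hae : (fun ω => F fun k => ε k ω) =ᵐ[μ]
      fun ω => ∑ η, (S η).indicator (fun _ => F fun k => boolVal (η k)) ω := by
    filter_upwards [h.ae_pattern] with ω ⟨η, hη⟩
    rw [Finset.sum_eq_single η]
    · rw [Set.indicator_of_mem (show ω ∈ S η from hη)]
      congr 1; funext k; exact hη k
    · intro η' _ hne
      refine Set.indicator_of_notMem (fun hmem => hne ?_) _
      funext k
      exact hinj _ _ ((hmem k).symm.trans (hη k))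
    · simp
  have hint : ∀ η ∈ (Finset.univ : Finset (Fin (m + 1) → Bool)),
      Integrable ((S η).indicator (fun _ => F fun k => boolVal (η k))) μ :=
    fun η _ => (integrable_const _).indicator (hmeas η)
  refine ⟨(integrable_finsetSum _ hint).congr ?_, ?_⟩
  · filter_upwards [hae] with ω hω
    exact hω.symm
  · rw [integral_congr_ae hae, integral_finsetSum _ hint, Finset.mul_sum]
    refine Finset.sum_congr rfl fun η _ => ?_
    rw [integral_indicator_const _ (hmeas η), h.real_pattern η, smul_eq_mul]

lemma measurableSet_abs_cosPoly_lt {m : ℕ} (a : Fin (m + 1) → ℝ) :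
    MeasurableSet {x | |cosPoly a x - 1 / 2| < envelopeFn x} := by
  have h1 : Measurable (cosPoly a) := by unfold cosPoly; fun_prop
  have h2 : Measurable envelopeFn := by unfold envelopeFn; fun_prop
  exact measurableSet_lt (by fun_prop) h2

/-- The number of `0`-`1` patterns whose cosine polynomial lies within the envelope at `x`. -/
noncomputable def patternCount (m : ℕ) (x : ℝ) : ℕ :=
  Finset.card {η : Fin (m + 1) → Bool |
    |cosPoly (fun k => boolVal (η k)) x - 1 / 2| < envelopeFn x}

lemma patternCount_eq_sum (m : ℕ) (x : ℝ) :
    (patternCount m x : ℝ) = ∑ η : Fin (m + 1) → Bool,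
      {x | |cosPoly (fun k => boolVal (η k)) x - 1 / 2| < envelopeFn x}.indicator 1 x := by
  simp only [patternCount, Finset.card_filter, Nat.cast_sum, Set.indicator_apply, Set.mem_ofPred_eq]
  exact Finset.sum_congr rfl fun η _ => by split_ifs <;> simp

lemma integrableOn_patternCount (m : ℕ) :
    IntegrableOn (fun x => (patternCount m x : ℝ)) (Set.Ioc 0 Real.pi) := by
  simp only [patternCount_eq_sum]
  refine integrable_finsetSum _ fun η _ => Integrable.indicator ?_ (measurableSet_abs_cosPoly_lt _)
  exact integrableOn_const (by simp)

lemma sum_volume_envelopeSet (m : ℕ) :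
    ∑ η : Fin (m + 1) → Bool, volume.real (envelopeSet (cosPoly fun k => boolVal (η k))) =
      ∫ x in Set.Ioc 0 Real.pi, (patternCount m x : ℝ) := by
  simp only [patternCount_eq_sum]
  rw [integral_finsetSum]
  · refine Finset.sum_congr rfl fun η _ => ?_
    rw [integral_indicator_one (measurableSet_abs_cosPoly_lt _),
      measureReal_restrict_apply (measurableSet_abs_cosPoly_lt _)]
    congr 1
    ext x
    simp [envelopeSet, and_comm]
  · exact fun η _ => Integrable.indicator (integrableOn_const (by simp))
      (measurableSet_abs_cosPoly_lt _)

/-! ### Anti-concentration of sums with coefficients bounded away from zero. -/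

/-- Induction on the ratio of consecutive central binomials, using `(2n+1)(2n+3) ≤ 4(n+1)²`; this
avoids Stirling's formula. -/
lemma centralBinom_sq_mul_le (n : ℕ) : n.centralBinom ^ 2 * (2 * n + 1) ≤ 16 ^ n := by
  induction n with
  | zero => simp
  | succ n ih =>
    have h := Nat.succ_mul_centralBinom_succ n
    have h2 : (n + 1) ^ 2 * ((n + 1).centralBinom ^ 2 * (2 * (n + 1) + 1)) ≤
        (n + 1) ^ 2 * 16 ^ (n + 1) := by
      calc (n + 1) ^ 2 * ((n + 1).centralBinom ^ 2 * (2 * (n + 1) + 1))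
          = ((n + 1) * (n + 1).centralBinom) ^ 2 * (2 * n + 3) := by ring
        _ = (n.centralBinom ^ 2 * (2 * n + 1)) * (4 * ((2 * n + 1) * (2 * n + 3))) := by
          rw [h]; ring
        _ ≤ 16 ^ n * (4 * (4 * (n + 1) ^ 2)) := by
          refine Nat.mul_le_mul ih (Nat.mul_le_mul_left _ ?_)
          nlinarith
        _ = (n + 1) ^ 2 * 16 ^ (n + 1) := by ring
    exact Nat.le_of_mul_le_mul_left h2 (by positivity)

lemma choose_half_sq_mul_le (p : ℕ) : (p.choose (p / 2)) ^ 2 * p ≤ 4 ^ p := by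
  rcases Nat.even_or_odd' p with ⟨q, rfl | rfl⟩
  · have h := centralBinom_sq_mul_le q
    rw [Nat.centralBinom_eq_two_mul_choose] at h
    rw [Nat.mul_div_cancel_left q two_pos, pow_mul]
    norm_num
    nlinarith [Nat.zero_le (((2 * q).choose q) ^ 2)]
  · have h := centralBinom_sq_mul_le (q + 1)
    have e : (q + 1).centralBinom = 2 * (2 * q + 1).choose q := by
      rw [Nat.centralBinom_eq_two_mul_choose, show 2 * (q + 1) = (2 * q + 1) + 1 by ring,
        Nat.choose_succ_succ, Nat.choose_symm_half]
      ring
    rw [e] at h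
    have e2 : (2 * q + 1) / 2 = q := by omega
    rw [e2]
    have e3 : (4 : ℕ) ^ (2 * q + 1) * 4 = 16 ^ (q + 1) := by
      rw [pow_succ, pow_mul, pow_succ]; norm_num; ring
    nlinarith [Nat.zero_le (((2 * q + 1).choose q) ^ 2)]

lemma choose_half_le (p : ℕ) (hp : 0 < p) :
    (p.choose (p / 2) : ℝ) ≤ 2 ^ p / Real.sqrt p := by
  have h : ((p.choose (p / 2) : ℝ)) ^ 2 * p ≤ (2 ^ p) ^ 2 := by
    rw [← pow_mul, mul_comm p 2, pow_mul]
    have := choose_half_sq_mul_le p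
    norm_num
    exact_mod_cast this
  rw [le_div_iff₀ (Real.sqrt_pos.2 (by exact_mod_cast hp))]
  refine le_of_sq_le_sq ?_ (by positivity)
  rwa [mul_pow, Real.sq_sqrt (Nat.cast_nonneg p)]

/-- The Littlewood–Offord problem, after Erdős: few `0`-`1` sums fall in a short interval. -/
lemma card_sum_mem_Ico_le {ι : Type*} [Fintype ι] [DecidableEq ι] (c : ι → ℝ) {δ : ℝ}
    (hc : ∀ i, δ ≤ |c i|) (a : ℝ) :
    Finset.card {η : ι → Bool | ∑ i, boolVal (η i) * c i ∈ Set.Ico a (a + δ)} ≤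
      (Fintype.card ι).choose (Fintype.card ι / 2) := by
  classical
  -- `T η` collects the indices whose term is at the larger of its values `0` and `c i`. Enlarging
  -- `T η` strictly raises the sum by at least `δ`, out of the half-open interval, so the sets form
  -- an antichain.
  set T : (ι → Bool) → Finset ι := fun η => {i | η i = decide (0 < c i)} with hT
  have hTinj : Function.Injective T := by
    intro η η' h
    funext i
    have : i ∈ T η ↔ i ∈ T η' := by rw [h]
    simp only [hT, Finset.mem_filter, Finset.mem_univ, true_and] at this
    revert this
    cases η i <;> cases η' i <;> cases decide (0 < c i) <;> simp
  rw [← Finset.card_image_of_injective _ hTinj]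
  apply IsAntichain.sperner
  intro A hA B hB hne hsub
  simp only [Finset.coe_image, Set.mem_image, Finset.mem_coe, Finset.mem_filter, Finset.mem_univ,
    true_and] at hA hB
  obtain ⟨η, hη, rfl⟩ := hA
  obtain ⟨η', hη', rfl⟩ := hB
  have hsub' : T η ⊆ T η' := hsub
  obtain ⟨j, hj', hj⟩ := Finset.exists_of_ssubset (hsub'.ssubset_of_ne hne)
  have key : ∀ i, boolVal (η i) * c i ≤ boolVal (η' i) * c i := by
    intro i
    have h1 : i ∈ T η → i ∈ T η' := fun h => hsub' h
    simp only [hT, Finset.mem_filter, Finset.mem_univ, true_and] at h1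
    by_cases hp : 0 < c i
    · simp only [hp, decide_true] at h1
      cases h : η i <;> cases h' : η' i <;> simp_all [boolVal, hp.le]
    · simp only [hp, decide_false] at h1
      have := not_lt.1 hp
      cases h : η i <;> cases h' : η' i <;> simp_all [boolVal]
  have keyj : boolVal (η j) * c j + δ ≤ boolVal (η' j) * c j := by
    simp only [hT, Finset.mem_filter, Finset.mem_univ, true_and] at hj hj'
    have hcj := hc j
    by_cases hp : 0 < c j
    · rw [abs_of_pos hp] at hcj
      simp only [hp, decide_true] at hj hj'
      cases h : η j <;> simp_all [boolVal]
    · rw [abs_of_nonpos (not_lt.1 hp)] at hcj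
      simp only [hp, decide_false] at hj hj'
      cases h : η j <;> simp_all [boolVal]
      linarith
  have : ∑ i, boolVal (η i) * c i + δ ≤ ∑ i, boolVal (η' i) * c i := by
    rw [← Finset.add_sum_erase _ _ (Finset.mem_univ j),
      ← Finset.add_sum_erase (a := j) (s := Finset.univ) (f := fun i => boolVal (η' i) * c i) (Finset.mem_univ j)]
    have := Finset.sum_le_sum fun i (_ : i ∈ Finset.univ.erase j) => key i
    linarith
  have := hη.1
  have := hη'.2
  linarith

/-- Fixing the bits outside `G` only translates the interval, so the antichain bound applies on each
fibre. -/
lemma card_sum_mem_Ico_le_of_subset {ι : Type*} [Fintype ι] [DecidableEq ι] (c : ι → ℝ) {δ : ℝ}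
    (G : Finset ι) (hG : 0 < G.card) (hc : ∀ i ∈ G, δ ≤ |c i|) (a : ℝ) :
    (Finset.card {η : ι → Bool | ∑ i, boolVal (η i) * c i ∈ Set.Ico a (a + δ)} : ℝ) ≤
      2 ^ Fintype.card ι / Real.sqrt G.card := by
  classical
  set e := Equiv.piEquivPiSubtypeProd (fun i => i ∈ G) (fun _ : ι => Bool)
  have hsplit : ∀ η : ι → Bool, ∑ i, boolVal (η i) * c i =
      ∑ i : {i // i ∈ G}, boolVal ((e η).1 i) * c i +
      ∑ i : {i // i ∉ G}, boolVal ((e η).2 i) * c i := by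
    intro η
    convert (Fintype.sum_subtype_add_sum_subtype (fun i => i ∈ G)
      (fun i => boolVal (η i) * c i)).symm <;> rfl
  have h1 : Finset.card {η : ι → Bool | ∑ i, boolVal (η i) * c i ∈ Set.Ico a (a + δ)} ≤
      (G.card.choose (G.card / 2)) * Finset.card (Finset.univ : Finset ({i // i ∉ G} → Bool)) := by
    refine Finset.card_le_mul_card_image_of_maps_to (f := fun η => (e η).2)
      (fun _ _ => Finset.mem_univ _) _ fun v _ => ?_
    have h2 := card_sum_mem_Ico_le (fun i : {i // i ∈ G} => c i) (fun i => hc i i.2)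
      (a - ∑ i : {i // i ∉ G}, boolVal (v i) * c i)
    rw [Fintype.card_coe] at h2
    refine le_trans (Finset.card_le_card_of_injOn (fun η => (e η).1) ?_ ?_) h2
    · intro η hη
      simp only [Finset.coe_filter, Finset.mem_filter, Finset.mem_univ, true_and,
        Set.mem_ofPred_eq] at hη ⊢
      obtain ⟨h3, rfl⟩ := hη
      rw [hsplit] at h3
      exact ⟨by linarith [h3.1], by linarith [h3.2]⟩
    · intro η hη η' hη' h
      simp only [Finset.coe_filter, Finset.mem_filter, Finset.mem_univ, true_and,
        Set.mem_ofPred_eq] at hη hη'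
      exact e.injective (Prod.ext h (hη.2.trans hη'.2.symm))
  have h3 : Finset.card (Finset.univ : Finset ({i // i ∉ G} → Bool)) =
      2 ^ (Fintype.card ι - G.card) := by
    rw [Finset.card_univ, Fintype.card_fun, Fintype.card_bool, Fintype.card_subtype_compl,
      Fintype.card_coe]
  rw [h3] at h1
  calc (Finset.card {η : ι → Bool | ∑ i, boolVal (η i) * c i ∈ Set.Ico a (a + δ)} : ℝ)
      ≤ (G.card.choose (G.card / 2) : ℝ) * 2 ^ (Fintype.card ι - G.card) := by exact_mod_cast h1
    _ ≤ 2 ^ G.card / Real.sqrt G.card * 2 ^ (Fintype.card ι - G.card) := by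
      gcongr
      exact choose_half_le _ hG
    _ = 2 ^ Fintype.card ι / Real.sqrt G.card := by
      rw [div_mul_eq_mul_div, ← pow_add, Nat.add_sub_cancel' (Finset.card_le_univ G)]

/-- An interval of length `2r` is covered by `⌊2r/δ⌋ + 1` half-open intervals of length `δ`. -/
lemma card_sum_mem_Ioo_le {ι : Type*} [Fintype ι] [DecidableEq ι] (c : ι → ℝ) {δ : ℝ}
    (hδ : 0 < δ) (G : Finset ι) (hG : 0 < G.card) (hc : ∀ i ∈ G, δ ≤ |c i|) (b r : ℝ)
    (hr : 0 ≤ r) :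
    (Finset.card {η : ι → Bool | |∑ i, boolVal (η i) * c i - b| < r} : ℝ) ≤
      (2 * r / δ + 1) * (2 ^ Fintype.card ι / Real.sqrt G.card) := by
  classical
  set S : Finset (ι → Bool) := {η | |∑ i, boolVal (η i) * c i - b| < r} with hS
  set w : (ι → Bool) → ℕ := fun η => ⌊(∑ i, boolVal (η i) * c i - b + r) / δ⌋₊ with hw
  have hmap : Set.MapsTo w S (Finset.range (⌊2 * r / δ⌋₊ + 1)) := by
    intro η hη
    simp only [hS, Finset.coe_filter, Finset.mem_univ, true_and, Set.mem_ofPred_eq, abs_lt] at hη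
    simp only [Finset.coe_range, Set.mem_Iio, hw, Nat.lt_succ_iff]
    refine Nat.floor_le_floor ?_
    gcongr
    linarith
  have hfib := Finset.card_eq_sum_card_fiberwise hmap
  rw [hfib]
  push_cast
  calc ∑ i ∈ Finset.range (⌊2 * r / δ⌋₊ + 1), ((S.filter fun η => w η = i).card : ℝ)
      ≤ ∑ i ∈ Finset.range (⌊2 * r / δ⌋₊ + 1), 2 ^ Fintype.card ι / Real.sqrt G.card := by
        refine Finset.sum_le_sum fun i _ => ?_
        refine le_trans ?_ (card_sum_mem_Ico_le_of_subset c G hG hc (b - r + δ * i))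
        norm_cast
        refine Finset.card_le_card fun η hη => ?_
        simp only [hS, Finset.mem_filter, Finset.mem_univ, true_and, abs_lt, hw] at hη ⊢
        obtain ⟨⟨h1, h2⟩, h3⟩ := hη
        have h4 : 0 ≤ (∑ i, boolVal (η i) * c i - b + r) / δ := by
          apply div_nonneg _ hδ.le; linarith
        obtain ⟨h5, h6⟩ := (Nat.floor_eq_iff h4).1 h3
        rw [le_div_iff₀ hδ] at h5
        rw [div_lt_iff₀ hδ] at h6
        exact ⟨by linarith, by linarith⟩
    _ = (⌊2 * r / δ⌋₊ + 1 : ℕ) * (2 ^ Fintype.card ι / Real.sqrt G.card) := by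
        rw [Finset.sum_const, Finset.card_range, nsmul_eq_mul]
    _ ≤ _ := by
        gcongr
        push_cast
        have := Nat.floor_le (show 0 ≤ 2 * r / δ by positivity)
        linarith

/-! ### Pointwise upper bound for the pattern count. -/

/-- At least a quarter of the numbers `cos (k x)`, `k ≤ m`, are bounded away from zero. -/
lemma le_four_mul_card_cos (m : ℕ) (x : ℝ) :
    m < 4 * Finset.card {k : Fin (m + 1) | 1 / 2 ≤ |Real.cos ((k : ℕ) * x)|} := by
  classical
  set G : Finset (Fin (m + 1)) := {k | 1 / 2 ≤ |Real.cos ((k : ℕ) * x)|} with hG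
  -- Since `cos 2θ = 2 cos² θ - 1`, for each `k ≤ m / 2` either `k` or `2k` belongs to `G`.
  have hsub : Finset.range (m / 2 + 1) ⊆
      G.image (fun k : Fin (m + 1) => (k : ℕ)) ∪ G.image (fun k : Fin (m + 1) => (k : ℕ) / 2) := by
    intro k hk
    rw [Finset.mem_range] at hk
    by_cases hc : 1 / 2 ≤ |Real.cos ((k : ℕ) * x)|
    · refine Finset.mem_union_left _ (Finset.mem_image.2 ⟨⟨k, by omega⟩, ?_, rfl⟩)
      simpa [hG] using hc
    · refine Finset.mem_union_right _ (Finset.mem_image.2 ⟨⟨2 * k, by omega⟩, ?_, by simp⟩)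
      simp only [hG, Finset.mem_filter, Finset.mem_univ, true_and]
      push_cast
      rw [mul_assoc, Real.cos_two_mul]
      have h1 := not_le.1 hc
      have h2 : Real.cos (k * x) ^ 2 < 1 / 4 := by
        rw [← sq_abs]; nlinarith [abs_nonneg (Real.cos (k * x))]
      rw [abs_of_nonpos (by linarith)]
      linarith
  have h1 := Finset.card_le_card hsub
  rw [Finset.card_range] at h1
  have h2 := Finset.card_union_le (G.image (fun k : Fin (m + 1) => (k : ℕ))) (G.image (fun k : Fin (m + 1) => (k : ℕ) / 2))
  have h3 := Finset.card_image_le (s := G) (f := fun k : Fin (m + 1) => (k : ℕ))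
  have h4 := Finset.card_image_le (s := G) (f := fun k : Fin (m + 1) => (k : ℕ) / 2)
  omega

lemma half_le_envelopeFn {x : ℝ} (hx : x ∈ Set.Ioc 0 Real.pi) : 1 / 2 ≤ envelopeFn x := by
  have h : 0 < Real.sin (x / 2) :=
    Real.sin_pos_of_pos_of_lt_pi (by linarith [hx.1]) (by linarith [hx.1, hx.2])
  unfold envelopeFn
  rw [one_div]
  exact inv_anti₀ (by positivity) (by linarith [Real.sin_le_one (x / 2)])

lemma patternCount_le {m : ℕ} (hm : 0 < m) {x : ℝ} (hx : x ∈ Set.Ioc 0 Real.pi) :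
    (patternCount m x : ℝ) ≤ 2 ^ (m + 1) * (12 * envelopeFn x / Real.sqrt m) := by
  set G : Finset (Fin (m + 1)) := {k | 1 / 2 ≤ |Real.cos ((k : ℕ) * x)|} with hG
  have hcard : m < 4 * G.card := le_four_mul_card_cos m x
  have hs := half_le_envelopeFn hx
  have h := card_sum_mem_Ioo_le (fun k : Fin (m + 1) => Real.cos ((k : ℕ) * x)) (δ := 1 / 2)
    (by norm_num) G (by omega) (fun i hi => by simpa [hG] using hi) (1 / 2) (envelopeFn x)
    (by linarith)
  rw [Fintype.card_fin] at h
  refine le_trans h ?_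
  have h1 : Real.sqrt m ≤ 2 * Real.sqrt G.card := by
    rw [Real.sqrt_le_left (by positivity), mul_pow, Real.sq_sqrt (by positivity)]
    norm_num
    exact_mod_cast hcard.le
  have hm' : 0 < Real.sqrt m := Real.sqrt_pos.2 (by exact_mod_cast hm)
  have h2 : 1 / Real.sqrt G.card ≤ 2 / Real.sqrt m := by
    rw [div_le_div_iff₀ (by linarith) hm']
    linarith
  calc (2 * envelopeFn x / (1 / 2) + 1) * (2 ^ (m + 1) / Real.sqrt G.card)
      = 2 ^ (m + 1) * ((4 * envelopeFn x + 1) * (1 / Real.sqrt G.card)) := by ring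
    _ ≤ 2 ^ (m + 1) * ((6 * envelopeFn x) * (2 / Real.sqrt m)) := by
      gcongr
      linarith
    _ = _ := by ring

/-! ### Concentration of centered sums with slowly varying coefficients. -/

/-- The centered `0`-`1` sum with coefficients `c`. -/
noncomputable def centeredSum {n : ℕ} (c : Fin n → ℝ) (u : Fin n → Bool) : ℝ :=
  ∑ j, (boolVal (u j) - 1 / 2) * c j

lemma sum_centeredSum_sq {n : ℕ} (c : Fin n → ℝ) :
    ∑ u : Fin n → Bool, centeredSum c u ^ 2 = 2 ^ n * ((∑ j, c j ^ 2) / 4) := by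
  induction n with
  | zero => simp [centeredSum]
  | succ n ih =>
    rw [← (Fin.consEquiv fun _ => Bool).sum_comp, Fintype.sum_prod_type]
    have h : ∀ (b : Bool) (v : Fin n → Bool),
        centeredSum c ((Fin.consEquiv fun _ => Bool) (b, v)) =
          (boolVal b - 1 / 2) * c 0 + centeredSum (fun j => c j.succ) v := by
      intro b v
      simp [centeredSum, Fin.consEquiv, Fin.sum_univ_succ]
    simp only [h, Fintype.sum_bool]
    rw [← Finset.sum_add_distrib, Fin.sum_univ_succ]
    have h2 : ∀ v : Fin n → Bool,
        ((boolVal true - 1 / 2) * c 0 + centeredSum (fun j => c j.succ) v) ^ 2 +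
        ((boolVal false - 1 / 2) * c 0 + centeredSum (fun j => c j.succ) v) ^ 2 =
        c 0 ^ 2 / 2 + 2 * centeredSum (fun j => c j.succ) v ^ 2 := by
      intro v
      simp only [boolVal, if_true, Bool.false_eq_true, if_false]
      ring
    simp only [h2]
    rw [Finset.sum_add_distrib, ← Finset.mul_sum, ih]
    simp
    ring

/-- Chebyshev's inequality for counting. -/
lemma card_mul_sq_le_sum_sq {V : Type*} [Fintype V] (f : V → ℝ) {t : ℝ} (ht : 0 ≤ t) :
    (Finset.card {u | t ≤ |f u|} : ℝ) * t ^ 2 ≤ ∑ u, f u ^ 2 := by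
  calc (Finset.card {u | t ≤ |f u|} : ℝ) * t ^ 2 = ∑ u with t ≤ |f u|, t ^ 2 := by
        rw [Finset.sum_const, nsmul_eq_mul]
    _ ≤ ∑ u with t ≤ |f u|, f u ^ 2 := by
        refine Finset.sum_le_sum fun u hu => ?_
        rw [← sq_abs (f u)]
        exact pow_le_pow_left₀ ht (Finset.mem_filter.1 hu).2 2
    _ ≤ ∑ u, f u ^ 2 :=
        Finset.sum_le_univ_sum_of_nonneg fun u => sq_nonneg _

/-- A function with second moment at most `M² / 4` has many near-collisions. -/
lemma card_sq_mul_le_card_near {V : Type*} [Fintype V] (f : V → ℝ) {t M : ℝ} (ht : 0 < t)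
    (htM : t ≤ M) (hf : ∑ u, f u ^ 2 ≤ M ^ 2 / 4 * Fintype.card V) :
    (Fintype.card V : ℝ) ^ 2 * (t / (8 * M)) ≤
      Finset.card {p : V × V | |f p.1 - f p.2| < t} := by
  classical
  have hM : 0 < M := ht.trans_le htM
  set S : Finset V := {u | |f u| < M} with hS
  have hcard : 3 / 4 * (Fintype.card V : ℝ) ≤ S.card := by
    have h1 := card_mul_sq_le_sum_sq f hM.le
    have h2 : S.card + Finset.card {u | M ≤ |f u|} = Fintype.card V := by
      rw [← Finset.card_univ,
        ← Finset.card_filter_add_card_filter_not (s := Finset.univ) (fun u => |f u| < M)]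
      simp [hS]
    have h3 : (S.card : ℝ) + Finset.card {u | M ≤ |f u|} = Fintype.card V := by exact_mod_cast h2
    have h4 : (Finset.card {u | M ≤ |f u|} : ℝ) ≤ 1 / 4 * Fintype.card V := by
      have : 0 < M ^ 2 := by positivity
      refine le_of_mul_le_mul_right ?_ this
      linarith
    linarith
  set N : ℕ := ⌊2 * M / t⌋₊ + 1 with hN
  set w : V → ℕ := fun u => ⌊(f u + M) / t⌋₊ with hw
  have hnn : ∀ u ∈ S, 0 ≤ (f u + M) / t := by
    intro u hu
    have := (abs_lt.1 (Finset.mem_filter.1 hu).2).1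
    exact div_nonneg (by linarith) ht.le
  have hmap : Set.MapsTo w S (Finset.range N) := by
    intro u hu
    have := (abs_lt.1 (Finset.mem_filter.1 (Finset.mem_coe.1 hu)).2).2
    simp only [Finset.coe_range, Set.mem_Iio, hw, hN, Nat.lt_succ_iff]
    refine Nat.floor_le_floor ?_
    gcongr
    linarith
  -- The right side is `3M/t`. Cauchy–Schwarz over the `N` cells then gives the proportion `(3/4)² /
  -- 3 = 3/16` of `t/M`, more than the `1/8` needed.
  have hNle : (N : ℝ) ≤ 4 * M / t * (9 / 16) * (4 / 3) := by
    have h1 := Nat.floor_le (show 0 ≤ 2 * M / t by positivity)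
    have h2 : 1 ≤ M / t := (one_le_div ht).2 htM
    have h3 : 2 * M / t = 2 * (M / t) := by ring
    have h4 : 4 * M / t * (9 / 16) * (4 / 3) = 3 * (M / t) := by ring
    rw [h4]
    push_cast [hN]
    linarith
  have hCS : (S.card : ℝ) ^ 2 ≤ N * ∑ i ∈ Finset.range N, ((S.filter fun u => w u = i).card : ℝ) ^ 2 := by
    rw [Finset.card_eq_sum_card_fiberwise hmap]
    push_cast
    have := sq_sum_le_card_mul_sum_sq (s := Finset.range N)
      (f := fun i => ((S.filter fun u => w u = i).card : ℝ))
    rwa [Finset.card_range] at this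
  have hcoll : ∑ i ∈ Finset.range N, ((S.filter fun u => w u = i).card : ℝ) ^ 2 ≤
      Finset.card {p : V × V | |f p.1 - f p.2| < t} := by
    have h1 : ∑ i ∈ Finset.range N, (S.filter fun u => w u = i).card ^ 2 =
        ((Finset.range N).biUnion fun i =>
          (S.filter fun u => w u = i) ×ˢ (S.filter fun u => w u = i)).card := by
      rw [Finset.card_biUnion]
      · exact Finset.sum_congr rfl fun i _ => by rw [Finset.card_product, sq]
      · intro i _ j _ hij
        rw [Function.onFun, Finset.disjoint_left]
        intro p hp hp'
        simp only [Finset.mem_product, Finset.mem_filter] at hp hp'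
        exact hij (hp.1.2.symm.trans hp'.1.2)
    have h2 : ∑ i ∈ Finset.range N, (S.filter fun u => w u = i).card ^ 2 ≤
        Finset.card {p : V × V | |f p.1 - f p.2| < t} := by
      rw [h1]
      refine Finset.card_le_card fun p hp => ?_
      simp only [Finset.mem_biUnion, Finset.mem_product, Finset.mem_filter] at hp
      obtain ⟨i, -, ⟨hp1, hw1⟩, hp2, hw2⟩ := hp
      obtain ⟨a1, a2⟩ := (Nat.floor_eq_iff (hnn _ hp1)).1 hw1
      obtain ⟨b1, b2⟩ := (Nat.floor_eq_iff (hnn _ hp2)).1 hw2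
      rw [le_div_iff₀ ht] at a1 b1
      rw [div_lt_iff₀ ht] at a2 b2
      simp only [Finset.mem_filter, Finset.mem_univ, true_and, abs_lt]
      constructor <;> linarith
    exact_mod_cast h2
  set K : ℝ := (Finset.card {p : V × V | |f p.1 - f p.2| < t} : ℝ)
  have hK : 0 ≤ K := Nat.cast_nonneg _
  have h1 : (3 / 4 * (Fintype.card V : ℝ)) ^ 2 ≤ (4 * M / t * (9 / 16) * (4 / 3)) * K := by
    calc (3 / 4 * (Fintype.card V : ℝ)) ^ 2 ≤ (S.card : ℝ) ^ 2 := by gcongr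
      _ ≤ N * K := hCS.trans (by gcongr)
      _ ≤ _ := by gcongr
  have h2 : (4 * M / t * (9 / 16) * (4 / 3)) * K = 3 * M * K / t := by ring
  rw [h2, le_div_iff₀ ht] at h1
  rw [← mul_div_assoc, div_le_iff₀ (by positivity)]
  have : 0 ≤ M * K := by positivity
  nlinarith

/-- A lower bound for the concentration of a sum over pairs with nearly equal coefficients. -/
lemma le_card_centeredSum_pair {n : ℕ} (c c' : Fin n → ℝ) {x t : ℝ}
    (hc : ∀ j, |c j| ≤ 1) (hcc : ∀ j, |c' j - c j| ≤ x) (ht : 0 < t) (htn : t ≤ Real.sqrt n) :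
    (4 : ℝ) ^ n * (t / (8 * Real.sqrt n) - n * x ^ 2 / (4 * t ^ 2)) ≤
      Finset.card {p : (Fin n → Bool) × (Fin n → Bool) |
        |centeredSum c p.1 + centeredSum c' p.2| < 2 * t} := by
  classical
  have hcardV : (Fintype.card (Fin n → Bool) : ℝ) = 2 ^ n := by simp
  have h4 : (4 : ℝ) ^ n = 2 ^ n * 2 ^ n := by rw [← mul_pow]; norm_num
  have hA := card_sq_mul_le_card_near (centeredSum c) ht htn (by
    rw [sum_centeredSum_sq, hcardV, Real.sq_sqrt (Nat.cast_nonneg n), mul_comm]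
    gcongr
    calc ∑ j, c j ^ 2 ≤ ∑ _j : Fin n, (1 : ℝ) := by
          refine Finset.sum_le_sum fun j _ => ?_
          exact (sq_le_one_iff_abs_le_one _).2 (hc j)
      _ = n := by simp)
  rw [hcardV] at hA
  set d : Fin n → ℝ := fun j => c' j - c j with hd
  have hB : (Finset.card {v | t ≤ |centeredSum d v|} : ℝ) * t ^ 2 ≤ 2 ^ n * (n * x ^ 2 / 4) := by
    refine (card_mul_sq_le_sum_sq (centeredSum d) ht.le).trans ?_
    rw [sum_centeredSum_sq]
    gcongr
    calc ∑ j, d j ^ 2 ≤ ∑ _j : Fin n, x ^ 2 := by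
          refine Finset.sum_le_sum fun j _ => ?_
          rw [← sq_abs]
          exact pow_le_pow_left₀ (abs_nonneg _) (hcc j) 2
      _ = n * x ^ 2 := by simp
  -- Complementing the second pattern turns near-collisions into near-cancellations.
  have hneg : ∀ v : Fin n → Bool, centeredSum c (fun j => !v j) = - centeredSum c v := by
    intro v
    rw [centeredSum, centeredSum, ← Finset.sum_neg_distrib]
    refine Finset.sum_congr rfl fun j _ => ?_
    cases v j <;> simp only [boolVal, Bool.not_true, Bool.not_false, Bool.false_eq_true,
      if_true, if_false] <;> ring
  have hadd : ∀ v : Fin n → Bool, centeredSum c' v = centeredSum c v + centeredSum d v := by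
    intro v
    simp only [centeredSum, ← Finset.sum_add_distrib, hd]
    exact Finset.sum_congr rfl fun j _ => by ring
  set P : Finset ((Fin n → Bool) × (Fin n → Bool)) :=
    {p | |centeredSum c p.1 + centeredSum c p.2| < t} with hP
  set Q : Finset ((Fin n → Bool) × (Fin n → Bool)) :=
    {p | |centeredSum c p.1 + centeredSum c' p.2| < 2 * t} with hQ
  set B : Finset (Fin n → Bool) := {v | t ≤ |centeredSum d v|} with hBdef
  have h1 : Finset.card {p : (Fin n → Bool) × (Fin n → Bool) |
      |centeredSum c p.1 - centeredSum c p.2| < t} ≤ P.card := by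
    refine Finset.card_le_card_of_injOn (fun p => (p.1, fun j => !p.2 j)) ?_ ?_
    · intro p hp
      simpa [hP, hneg, ← sub_eq_add_neg] using hp
    · intro p _ q _ h
      simp only [Prod.mk.injEq] at h
      refine Prod.ext h.1 (funext fun j => ?_)
      simpa using congrFun h.2 j
  -- Replacing `c` by `c'` shifts the sum by `centeredSum d`, which is below `t` in absolute value
  -- outside the Chebyshev exceptional set `B`.
  have h2 : P ⊆ Q ∪ Finset.univ ×ˢ B := by
    intro p hp
    by_cases hb : t ≤ |centeredSum d p.2|
    · exact Finset.mem_union_right _ (by simp [hBdef, hb])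
    · refine Finset.mem_union_left _ ?_
      simp only [hP, hQ, Finset.mem_filter, Finset.mem_univ, true_and, abs_lt, not_le, hadd] at *
      constructor <;> linarith
  have h3 : P.card ≤ Q.card + 2 ^ n * B.card := by
    refine (Finset.card_le_card h2).trans ((Finset.card_union_le _ _).trans ?_)
    simp [Finset.card_product]
  have h4' : (P.card : ℝ) ≤ Q.card + 2 ^ n * B.card := by exact_mod_cast h3
  have h1' : (2 ^ n : ℝ) ^ 2 * (t / (8 * Real.sqrt n)) ≤ P.card := hA.trans (by exact_mod_cast h1)
  have h5 : (2 : ℝ) ^ n * B.card ≤ 2 ^ n * (2 ^ n * (n * x ^ 2 / (4 * t ^ 2))) := by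
    gcongr
    rw [← div_div, ← mul_div_assoc, le_div_iff₀ (by positivity)]
    exact hB
  rw [h4]
  nlinarith

/-- Splitting a pattern of length `2n` into its entries of even and odd index. -/
def evenOddEquiv (n : ℕ) : (Fin (n * 2) → Bool) ≃ (Fin n → Bool) × (Fin n → Bool) :=
  ((Equiv.arrowCongr (((Equiv.prodComm _ _).trans finProdFinEquiv).symm) (Equiv.refl Bool)).trans
    (Equiv.curry _ _ _)).trans (piFinTwoEquiv fun _ => Fin n → Bool)

lemma sum_fin_mul_two {n : ℕ} (f : Fin (n * 2) → ℝ) :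
    ∑ k, f k = ∑ j : Fin n, f ⟨2 * j, by omega⟩ + ∑ j : Fin n, f ⟨2 * j + 1, by omega⟩ := by
  rw [← finProdFinEquiv.sum_comp, Fintype.sum_prod_type, ← Finset.sum_add_distrib]
  refine Finset.sum_congr rfl fun j _ => ?_
  rw [Fin.sum_univ_two]
  congr 2
  · ext; simp [finProdFinEquiv]
  · ext; simp [finProdFinEquiv, add_comm]

lemma evenOddEquiv_fst {n : ℕ} (η : Fin (n * 2) → Bool) (j : Fin n) :
    (evenOddEquiv n η).1 j = η ⟨2 * j, by omega⟩ := by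
  simp only [evenOddEquiv, Equiv.trans_apply, piFinTwoEquiv_apply, Equiv.curry_apply,
    Function.curry, Equiv.arrowCongr_apply]
  simp
  congr 1
  ext
  simp [finProdFinEquiv]

lemma evenOddEquiv_snd {n : ℕ} (η : Fin (n * 2) → Bool) (j : Fin n) :
    (evenOddEquiv n η).2 j = η ⟨2 * j + 1, by omega⟩ := by
  simp only [evenOddEquiv, Equiv.trans_apply, piFinTwoEquiv_apply, Equiv.curry_apply,
    Function.curry, Equiv.arrowCongr_apply]
  simp
  congr 1
  ext
  simp [finProdFinEquiv, add_comm]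

/-- Concentration of a centered sum whose consecutive coefficients are nearly equal. -/
lemma le_card_centeredSum {n : ℕ} (c : ℕ → ℝ) {x t : ℝ} (hc : ∀ j, |c j| ≤ 1)
    (hcc : ∀ j, |c (j + 1) - c j| ≤ x) (ht : 0 < t) (htn : t ≤ Real.sqrt n) :
    (2 : ℝ) ^ (n * 2) * (t / (8 * Real.sqrt n) - n * x ^ 2 / (4 * t ^ 2)) ≤
      Finset.card {η : Fin (n * 2) → Bool | |centeredSum (fun k => c k) η| < 2 * t} := by
  have h := le_card_centeredSum_pair (n := n) (fun j => c (2 * j)) (fun j => c (2 * j + 1))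
    (fun _ => hc _) (fun _ => hcc _) ht htn
  rw [mul_comm n 2, pow_mul]
  norm_num at h ⊢
  refine h.trans ?_
  rw [Nat.cast_le, mul_comm 2 n]
  refine (Finset.card_equiv (evenOddEquiv n) fun η => ?_).ge
  have : centeredSum (fun k => c k) η =
      centeredSum (fun j : Fin n => c (2 * j)) (evenOddEquiv n η).1 +
      centeredSum (fun j : Fin n => c (2 * j + 1)) (evenOddEquiv n η).2 := by
    simp only [centeredSum, evenOddEquiv_fst, evenOddEquiv_snd]
    exact sum_fin_mul_two _
  simp only [Finset.mem_filter, Finset.mem_univ, true_and, this]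

/-- For odd `N` the last index has no partner; either value of its bit moves the centered sum by at
most `1/2`. -/
lemma le_card_centeredSum_add_half (N : ℕ) (c : ℕ → ℝ) {x t : ℝ} (hc : ∀ j, |c j| ≤ 1)
    (hcc : ∀ j, |c (j + 1) - c j| ≤ x) (ht : 0 < t) (htn : t ≤ Real.sqrt (N / 2 : ℕ)) :
    (2 : ℝ) ^ N * (t / (8 * Real.sqrt (N / 2 : ℕ)) - (N / 2 : ℕ) * x ^ 2 / (4 * t ^ 2)) ≤
      Finset.card {η : Fin N → Bool | |centeredSum (fun k => c k) η| < 2 * t + 1 / 2} := by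
  classical
  have key := le_card_centeredSum (n := N / 2) c hc hcc ht htn
  rcases Nat.even_or_odd' N with ⟨n, rfl | rfl⟩
  · have e : 2 * n / 2 = n := by omega
    rw [e] at key ⊢
    rw [mul_comm 2 n]
    refine key.trans ?_
    rw [Nat.cast_le]
    refine Finset.card_le_card fun η hη => ?_
    simp only [Finset.mem_filter, Finset.mem_univ, true_and] at hη ⊢
    linarith
  · have e : (2 * n + 1) / 2 = n := by omega
    rw [e] at key ⊢
    rw [mul_comm 2 n]
    have h : 2 * Finset.card {η : Fin (n * 2) → Bool | |centeredSum (fun k => c k) η| < 2 * t} ≤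
        Finset.card {η : Fin (n * 2 + 1) → Bool |
          |centeredSum (fun k => c k) η| < 2 * t + 1 / 2} := by
      rw [← Fintype.card_bool, ← Finset.card_univ, ← Finset.card_product, Finset.card_univ,
        Fintype.card_bool]
      refine Finset.card_le_card_of_injOn (Fin.snocEquiv fun _ => Bool) ?_
        (Equiv.injective _).injOn
      rintro ⟨b, v⟩ hp
      simp only [Finset.coe_product, Finset.coe_filter, Set.mem_prod, Finset.mem_coe,
        Finset.mem_univ, true_and, Set.mem_ofPred_eq] at hp ⊢
      have h1 : centeredSum (fun k : Fin (n * 2 + 1) => c k)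
          ((Fin.snocEquiv fun _ => Bool) (b, v)) =
          centeredSum (fun k : Fin (n * 2) => c k) v + (boolVal b - 1 / 2) * c (n * 2) := by
        simp [centeredSum, Fin.snocEquiv, Fin.sum_univ_castSucc]
      have h2 : |(boolVal b - 1 / 2) * c (n * 2)| ≤ 1 / 2 := by
        rw [abs_mul]
        have : |boolVal b - 1 / 2| = 1 / 2 := by cases b <;> norm_num [boolVal, abs_of_nonneg]
        rw [this]
        linarith [hc (n * 2)]
      rw [h1]
      exact (abs_add_le _ _).trans_lt (by linarith)
    rw [pow_succ]
    have h' : 2 * (Finset.card {η : Fin (n * 2) → Bool |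
        |centeredSum (fun k => c k) η| < 2 * t} : ℝ) ≤
        Finset.card {η : Fin (n * 2 + 1) → Bool |
          |centeredSum (fun k => c k) η| < 2 * t + 1 / 2} := by exact_mod_cast h
    linarith

/-! ### The Dirichlet kernel, the envelope and the pointwise lower bound. -/

lemma two_mul_sin_mul_sum_cos (m : ℕ) (x : ℝ) :
    2 * Real.sin (x / 2) * ∑ k : Fin (m + 1), Real.cos ((k : ℕ) * x) =
      Real.sin (x / 2) + Real.sin ((m + 1 / 2) * x) := by
  induction m with
  | zero =>
    simp
    ring_nf
  | succ m ih =>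
    rw [Fin.sum_univ_castSucc, mul_add]
    simp only [Fin.val_castSucc, Fin.val_last]
    rw [ih]
    push_cast
    have h1 : ((m : ℝ) + 1 + 1 / 2) * x = (m + 1) * x + x / 2 := by ring
    have h2 : ((m : ℝ) + 1 / 2) * x = (m + 1) * x - x / 2 := by ring
    rw [h1, h2, Real.sin_add, Real.sin_sub]
    ring

lemma sin_half_pos {x : ℝ} (hx : x ∈ Set.Ioc 0 Real.pi) : 0 < Real.sin (x / 2) :=
  Real.sin_pos_of_pos_of_lt_pi (by linarith [hx.1]) (by linarith [hx.1, hx.2])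

/-- The mean of the random cosine polynomial stays within the envelope. -/
lemma abs_half_sum_cos_sub_le (m : ℕ) {x : ℝ} (hx : x ∈ Set.Ioc 0 Real.pi) :
    |1 / 2 * ∑ k : Fin (m + 1), Real.cos ((k : ℕ) * x) - 1 / 2| ≤
      1 / 4 + envelopeFn x / 2 := by
  have hs := sin_half_pos hx
  have h : 1 / 2 * ∑ k : Fin (m + 1), Real.cos ((k : ℕ) * x) - 1 / 2 =
      -(1 / 4) + Real.sin ((m + 1 / 2) * x) * envelopeFn x / 2 := by
    have := two_mul_sin_mul_sum_cos m x
    rw [mul_comm, ← eq_div_iff (by positivity)] at this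
    rw [this, envelopeFn]
    field_simp
    ring
  have he : 0 ≤ envelopeFn x := by linarith [half_le_envelopeFn hx]
  rw [h, abs_le]
  constructor
  · nlinarith [Real.neg_one_le_sin ((m + 1 / 2) * x)]
  · nlinarith [Real.sin_le_one ((m + 1 / 2) * x)]

lemma inv_le_envelopeFn {x : ℝ} (hx : x ∈ Set.Ioc 0 Real.pi) : x⁻¹ ≤ envelopeFn x := by
  have h := sin_half_pos hx
  unfold envelopeFn
  refine inv_anti₀ (by positivity) ?_
  linarith [Real.sin_le (show 0 ≤ x / 2 by linarith [hx.1])]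

lemma envelopeFn_le {x : ℝ} (hx : x ∈ Set.Ioc 0 Real.pi) : envelopeFn x ≤ 2 * x⁻¹ := by
  have h := Real.mul_le_sin (show 0 ≤ x / 2 by linarith [hx.1])
    (show x / 2 ≤ Real.pi / 2 by linarith [hx.2])
  unfold envelopeFn
  have h2 : 2 * x⁻¹ = (x / 2)⁻¹ := by rw [inv_div]; rfl
  rw [h2]
  refine inv_anti₀ (by linarith [hx.1]) ?_
  have h3 : 1 / 2 ≤ 2 / Real.pi := by
    rw [div_le_div_iff₀ two_pos Real.pi_pos]
    linarith [Real.pi_le_four]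
  have h4 := mul_le_mul_of_nonneg_right h3 (show 0 ≤ x / 2 by linarith [hx.1])
  linarith

lemma cosPoly_boolVal {m : ℕ} (η : Fin (m + 1) → Bool) (x : ℝ) :
    cosPoly (fun k => boolVal (η k)) x =
      centeredSum (fun k : Fin (m + 1) => Real.cos ((k : ℕ) * x)) η +
      1 / 2 * ∑ k : Fin (m + 1), Real.cos ((k : ℕ) * x) := by
  rw [cosPoly, centeredSum, Finset.mul_sum, ← Finset.sum_add_distrib]
  exact Finset.sum_congr rfl fun k _ => by ring

lemma le_patternCount {m : ℕ} (hm : 0 < m) {x : ℝ} (hx0 : 0 < x) (hx : x ≤ 1 / 3)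
    (hxm : 1 ≤ x * Real.sqrt m) (hx5 : 2048 * x ^ 5 * (m * Real.sqrt m) ≤ 1) :
    (2 : ℝ) ^ (m + 1) / (128 * Real.sqrt m) * x⁻¹ ≤ patternCount m x := by
  have hmem : x ∈ Set.Ioc 0 Real.pi := ⟨hx0, by linarith [Real.pi_gt_three]⟩
  set n : ℕ := (m + 1) / 2 with hn
  have hn0 : 0 < n := by omega
  have hnm : n ≤ m := by omega
  have hm64 : m ≤ 64 * n := by omega
  have hsm : 0 < Real.sqrt m := Real.sqrt_pos.2 (by exact_mod_cast hm)
  have hsn : 0 < Real.sqrt n := Real.sqrt_pos.2 (by exact_mod_cast hn0)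
  have hsnm : Real.sqrt n ≤ Real.sqrt m := Real.sqrt_le_sqrt (by exact_mod_cast hnm)
  have hsm8 : Real.sqrt m ≤ 8 * Real.sqrt n := by
    rw [Real.sqrt_le_left (by positivity), mul_pow, Real.sq_sqrt (by positivity)]
    norm_num
    exact_mod_cast hm64
  -- The mean leaves room `s/2 - 1/4`, and `2t + 1/2 = 1/(4x) + 1/2` fits because `s ≥ 1/x ≥ 3`.
  -- With this `t`, `hx5` makes the Chebyshev loss `16 n x⁴` at most half of the main term's lower
  -- bound `1/(64 x √m)`.
  set t : ℝ := x⁻¹ / 8 with ht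
  have hxi : 0 < x⁻¹ := inv_pos.2 hx0
  have hxim : x⁻¹ ≤ Real.sqrt m := by
    rw [inv_le_iff_one_le_mul₀ hx0]; linarith
  have h := le_card_centeredSum_add_half (m + 1) (fun k => Real.cos (k * x)) (x := x) (t := t)
    (fun j => Real.abs_cos_le_one _) (fun j => by
      have := Real.abs_cos_sub_cos_le ((j + 1 : ℕ) * x) (j * x)
      refine this.trans (le_of_eq ?_)
      push_cast
      rw [show ((j : ℝ) + 1) * x - j * x = x by ring, abs_of_pos hx0])
    (by positivity) (by rw [ht]; linarith)
  rw [← hn] at h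
  have hcount : (Finset.card {η : Fin (m + 1) → Bool |
      |centeredSum (fun k : Fin (m + 1) => Real.cos ((k : ℕ) * x)) η| < 2 * t + 1 / 2} : ℝ) ≤
      patternCount m x := by
    rw [Nat.cast_le]
    refine Finset.card_le_card fun η hη => ?_
    simp only [Finset.mem_filter, Finset.mem_univ, true_and] at hη ⊢
    rw [cosPoly_boolVal, add_sub_assoc]
    refine (abs_add_le _ _).trans_lt ?_
    have h1 := abs_half_sum_cos_sub_le m hmem
    have h2 := inv_le_envelopeFn hmem
    have h3 : 3 ≤ x⁻¹ := by
      rw [le_inv_comm₀ (by norm_num) hx0]; linarith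
    linarith
  refine le_trans ?_ (h.trans hcount)
  rw [div_mul_eq_mul_div, mul_div_assoc]
  gcongr
  have h1 : x⁻¹ / (64 * Real.sqrt m) ≤ t / (8 * Real.sqrt n) := by
    rw [ht, div_div, show 8 * (8 * Real.sqrt n) = 64 * Real.sqrt n by ring]
    gcongr
  have h2 : n * x ^ 2 / (4 * t ^ 2) ≤ x⁻¹ / (128 * Real.sqrt m) := by
    have e1 : n * x ^ 2 / (4 * t ^ 2) = 16 * n * x ^ 4 := by
      rw [ht]; field_simp; norm_num
    have e2 : x⁻¹ / (128 * Real.sqrt m) = 1 / (128 * Real.sqrt m * x) := by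
      rw [← one_div, div_div, mul_comm x]
    rw [e1, e2, le_div_iff₀ (by positivity)]
    calc 16 * (n : ℝ) * x ^ 4 * (128 * Real.sqrt m * x)
        ≤ 16 * (m : ℝ) * x ^ 4 * (128 * Real.sqrt m * x) := by gcongr
      _ = 2048 * x ^ 5 * (m * Real.sqrt m) := by ring
      _ ≤ 1 := hx5
  have e3 : x⁻¹ / (64 * Real.sqrt m) = 2 * (x⁻¹ / (128 * Real.sqrt m)) := by
    field_simp; norm_num
  linarith

/-! ### Integration over `x` and conclusion. -/

lemma setIntegral_Ioc_const_mul_inv {a b : ℝ} (ha : 0 < a) (hab : a ≤ b) (K : ℝ) :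
    IntegrableOn (fun x => K * x⁻¹) (Set.Ioc a b) ∧
    ∫ x in Set.Ioc a b, K * x⁻¹ = K * (Real.log b - Real.log a) := by
  constructor
  · refine Integrable.const_mul ?_ K
    rw [← IntegrableOn, ← intervalIntegrable_iff_integrableOn_Ioc_of_le hab]
    refine intervalIntegral.intervalIntegrable_inv (fun x hx => ?_) continuousOn_id
    rw [Set.uIcc_of_le hab] at hx
    exact (ha.trans_le hx.1).ne'
  · rw [integral_const_mul, ← intervalIntegral.integral_of_le hab,
      integral_inv_of_pos ha (ha.trans_le hab), Real.log_div (ha.trans_le hab).ne' ha.ne']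

lemma exists_le_integral_patternCount :
    ∃ M : ℕ, ∀ m : ℕ, M ≤ m → 2 ^ (m + 1) * (1 / 768 * (Real.log m / Real.sqrt m)) ≤
      ∫ x in Set.Ioc 0 Real.pi, (patternCount m x : ℝ) := by
  refine ⟨2048 ^ 6, fun m hm => ?_⟩
  have hmR : (2048 : ℝ) ^ 6 ≤ m := by exact_mod_cast hm
  -- The window is `y⁻³ < x ≤ y⁻²`, of logarithmic length `log y = log m / 6`, whence `768 = 128 ·
  -- 6`. The threshold `2048 ^ 6` ensures `2048 / y ≤ 1`, which is `hx5` at the right endpoint.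
  set y : ℝ := (m : ℝ) ^ (1 / 6 : ℝ) with hy
  have hy6 : y ^ 6 = m := by
    rw [hy, ← Real.rpow_natCast, ← Real.rpow_mul (Nat.cast_nonneg m)]
    norm_num
  have hy0 : 0 ≤ y := by positivity
  have hy1 : 2048 ≤ y := le_of_pow_le_pow_left₀ (by norm_num) hy0 (hmR.trans hy6.ge)
  have hypos : 0 < y := by linarith
  have hsq : Real.sqrt m = y ^ 3 := by
    rw [← hy6, show y ^ 6 = (y ^ 3) ^ 2 by ring, Real.sqrt_sq (by positivity)]
  have hab : (y ^ 3)⁻¹ ≤ (y ^ 2)⁻¹ :=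
    inv_anti₀ (by positivity) (pow_le_pow_right₀ (by linarith) (by norm_num))
  have hb : (y ^ 2)⁻¹ ≤ 1 / 3 := by
    rw [← one_div]
    exact one_div_le_one_div_of_le (by norm_num) (by nlinarith)
  obtain ⟨hint, hval⟩ := setIntegral_Ioc_const_mul_inv (a := (y ^ 3)⁻¹) (by positivity) hab
    ((2 : ℝ) ^ (m + 1) / (128 * Real.sqrt m))
  have hsub : Set.Ioc (y ^ 3)⁻¹ (y ^ 2)⁻¹ ⊆ Set.Ioc 0 Real.pi := fun x hx =>
    ⟨lt_trans (by positivity) hx.1, by linarith [hx.2, Real.pi_gt_three]⟩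
  calc 2 ^ (m + 1) * (1 / 768 * (Real.log m / Real.sqrt m))
      = (2 : ℝ) ^ (m + 1) / (128 * Real.sqrt m) *
          (Real.log (y ^ 2)⁻¹ - Real.log (y ^ 3)⁻¹) := by
        rw [Real.log_inv, Real.log_inv, Real.log_pow, Real.log_pow,
          show Real.log m = 6 * Real.log y by rw [← hy6, Real.log_pow]; norm_num]
        push_cast
        field_simp
        ring
    _ = ∫ x in Set.Ioc (y ^ 3)⁻¹ (y ^ 2)⁻¹, (2 : ℝ) ^ (m + 1) / (128 * Real.sqrt m) * x⁻¹ :=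
        hval.symm
    _ ≤ ∫ x in Set.Ioc (y ^ 3)⁻¹ (y ^ 2)⁻¹, (patternCount m x : ℝ) := by
        refine setIntegral_mono_on hint ((integrableOn_patternCount m).mono_set hsub)
          measurableSet_Ioc fun x hx => ?_
        have hx0 : 0 < x := (hsub hx).1
        refine le_patternCount (by omega) hx0 (hx.2.trans hb) ?_ ?_
        · rw [hsq, ← inv_le_iff_one_le_mul₀ (by positivity)]
          exact hx.1.le
        · rw [hsq, ← hy6]
          calc 2048 * x ^ 5 * (y ^ 6 * y ^ 3)
              ≤ 2048 * ((y ^ 2)⁻¹) ^ 5 * (y ^ 6 * y ^ 3) := by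
                gcongr
                exact hx.2
            _ = 2048 / y := by field_simp
            _ ≤ 1 := (div_le_one hypos).2 hy1
    _ ≤ _ := setIntegral_mono_set (integrableOn_patternCount m)
        (Filter.Eventually.of_forall fun x => Nat.cast_nonneg _) hsub.eventuallyLE

/-- The zero pattern alone suffices, since `s > 1/2` on `(0, π)`; the endpoint `π`, where `s = 1/2`,
is null. This serves bounded `m`. -/
lemma pi_le_integral_patternCount (m : ℕ) :
    Real.pi ≤ ∫ x in Set.Ioc 0 Real.pi, (patternCount m x : ℝ) := by
  rw [← sum_volume_envelopeSet]
  refine le_trans ?_ (Finset.single_le_sum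
    (f := fun η : Fin (m + 1) → Bool =>
      volume.real (envelopeSet (cosPoly fun k => boolVal (η k))))
    (fun _ _ => measureReal_nonneg) (Finset.mem_univ fun _ => false))
  have hsub : Set.Ioo 0 Real.pi ⊆
      envelopeSet (cosPoly fun _ : Fin (m + 1) => boolVal false) := by
    intro x hx
    refine ⟨⟨hx.1, hx.2.le⟩, ?_⟩
    have h0 : cosPoly (fun _ : Fin (m + 1) => boolVal false) x = 0 := by simp [cosPoly, boolVal]
    have h1 := sin_half_pos ⟨hx.1, hx.2.le⟩
    have h2 : Real.sin (x / 2) < 1 := by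
      rw [← Real.sin_pi_div_two]
      exact Real.sin_lt_sin_of_lt_of_le_pi_div_two (by linarith [hx.1, Real.pi_pos]) le_rfl
        (by linarith [hx.2])
    rw [h0, zero_sub, abs_neg, abs_of_pos one_half_pos, envelopeFn, one_div]
    exact inv_strictAnti₀ (by positivity) (by linarith)
  calc Real.pi = volume.real (Set.Ioo 0 Real.pi) := by
        rw [Real.volume_real_Ioo_of_le Real.pi_pos.le, sub_zero]
    _ ≤ _ := measureReal_mono hsub (ne_top_of_le_ne_top
        (measure_Ioc_lt_top (a := 0) (b := Real.pi)).ne (measure_mono fun x hx => hx.1))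

lemma integral_patternCount_le {m : ℕ} (hm : 2 ≤ m) :
    ∫ x in Set.Ioc 0 Real.pi, (patternCount m x : ℝ) ≤
      2 ^ (m + 1) * (200 * (Real.log m / Real.sqrt m)) := by
  have hmR : (2 : ℝ) ≤ m := by exact_mod_cast hm
  have hs1 : 1 ≤ Real.sqrt m := Real.one_le_sqrt.2 (by linarith)
  have hs0 : 0 < Real.sqrt m := by linarith
  have hlog : 1 / 2 ≤ Real.log m := by
    have := Real.log_le_log two_pos hmR
    linarith [Real.log_two_gt_d9]
  set a : ℝ := (Real.sqrt m)⁻¹ with ha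
  have ha0 : 0 < a := by positivity
  have ha1 : a ≤ 1 := inv_le_one_of_one_le₀ hs1
  have hapi : a ≤ Real.pi := by linarith [Real.pi_gt_three]
  have hI := integrableOn_patternCount m
  have hsub1 : Set.Ioc 0 a ⊆ Set.Ioc 0 Real.pi := Set.Ioc_subset_Ioc_right hapi
  have hsub2 : Set.Ioc a Real.pi ⊆ Set.Ioc 0 Real.pi := Set.Ioc_subset_Ioc_left ha0.le
  rw [← Set.Ioc_union_Ioc_eq_Ioc ha0.le hapi,
    setIntegral_union (Set.Ioc_disjoint_Ioc_of_le le_rfl) measurableSet_Ioc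
      (hI.mono_set hsub1) (hI.mono_set hsub2)]
  have h1 : ∫ x in Set.Ioc 0 a, (patternCount m x : ℝ) ≤ 2 ^ (m + 1) * a := by
    calc ∫ x in Set.Ioc 0 a, (patternCount m x : ℝ) ≤ ∫ _x in Set.Ioc 0 a, (2 : ℝ) ^ (m + 1) := by
          refine setIntegral_mono_on (hI.mono_set hsub1) (integrableOn_const (by simp))
            measurableSet_Ioc fun x _ => ?_
          have : patternCount m x ≤ 2 ^ (m + 1) := by
            refine (Finset.card_le_univ _).trans ?_
            simp
          exact_mod_cast this
      _ = 2 ^ (m + 1) * a := by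
          rw [setIntegral_const, Real.volume_real_Ioc_of_le ha0.le, sub_zero, smul_eq_mul,
            mul_comm]
  obtain ⟨hint, hval⟩ := setIntegral_Ioc_const_mul_inv ha0 hapi
    ((2 : ℝ) ^ (m + 1) * (24 / Real.sqrt m))
  have h2 : ∫ x in Set.Ioc a Real.pi, (patternCount m x : ℝ) ≤
      2 ^ (m + 1) * (24 / Real.sqrt m) * (Real.log Real.pi - Real.log a) := by
    rw [← hval]
    refine setIntegral_mono_on (hI.mono_set hsub2) hint measurableSet_Ioc fun x hx => ?_
    refine (patternCount_le (by omega) (hsub2 hx)).trans ?_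
    calc (2 : ℝ) ^ (m + 1) * (12 * envelopeFn x / Real.sqrt m)
        ≤ 2 ^ (m + 1) * (12 * (2 * x⁻¹) / Real.sqrt m) := by
          gcongr
          exact envelopeFn_le (hsub2 hx)
      _ = _ := by ring
  have hloga : Real.log a = -(Real.log m / 2) := by
    rw [ha, Real.log_inv, Real.log_sqrt (by linarith)]
  have hlogpi : Real.log Real.pi ≤ 3 := by
    linarith [Real.log_le_sub_one_of_pos Real.pi_pos, Real.pi_le_four]
  -- After clearing `√m` this reads `1 + 24 (log π + (log m)/2) ≤ 200 log m`; the constants are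
  -- absorbed by `log m ≥ 1/2`.
  have h3 : a + 24 / Real.sqrt m * (Real.log Real.pi - Real.log a) ≤
      200 * (Real.log m / Real.sqrt m) := by
    rw [hloga, ha, inv_eq_one_div, ← mul_div_assoc, div_mul_eq_mul_div, ← add_div]
    gcongr
    linarith
  calc _ ≤ 2 ^ (m + 1) * a +
        2 ^ (m + 1) * (24 / Real.sqrt m) * (Real.log Real.pi - Real.log a) := add_le_add h1 h2
    _ = 2 ^ (m + 1) * (a + 24 / Real.sqrt m * (Real.log Real.pi - Real.log a)) := by ring
    _ ≤ _ := by gcongr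

lemma log_div_sqrt_le_two {m : ℕ} (hm : 0 < m) : Real.log m / Real.sqrt m ≤ 2 := by
  have hmR : (0 : ℝ) < m := by exact_mod_cast hm
  have hs : 0 < Real.sqrt m := Real.sqrt_pos.2 hmR
  have h := Real.log_le_sub_one_of_pos hs
  rw [Real.log_sqrt hmR.le] at h
  rw [div_le_iff₀ hs]
  linarith

theorem mainTheorem5 :
    ∃ c C : ℝ, 0 < c ∧ 0 < C ∧
      ∀ m : ℕ, 2 ≤ m →
        ∀ {Ω : Type*} [MeasurableSpace Ω] (μ : Measure Ω) [IsProbabilityMeasure μ]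
          (ε : Fin (m + 1) → Ω → ℝ), IsFairBernoulliFamily μ ε →
          Integrable (fun ω => volume.real (envelopeSet (cosPoly fun k => ε k ω))) μ ∧
          c * (Real.log m / Real.sqrt m)
              ≤ ∫ ω, volume.real (envelopeSet (cosPoly fun k => ε k ω)) ∂μ ∧
          ∫ ω, volume.real (envelopeSet (cosPoly fun k => ε k ω)) ∂μ
              ≤ C * (Real.log m / Real.sqrt m) := by
  obtain ⟨M, hM⟩ := exists_le_integral_patternCount
  -- The second entry serves `m ≤ M`, where the zero pattern contributes `π / 2 ^ (m + 1)` and `log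
  -- m / √m ≤ 2 ≤ π`.
  refine ⟨min (1 / 768) ((1 / 2) ^ (M + 1)), 200, by positivity, by norm_num, ?_⟩
  intro m hm Ω _ μ _ ε hε
  obtain ⟨hint, hval⟩ :=
    hε.integrable_and_integral fun a => volume.real (envelopeSet (cosPoly a))
  rw [sum_volume_envelopeSet] at hval
  have hL : 0 ≤ Real.log m / Real.sqrt m :=
    div_nonneg (Real.log_natCast_nonneg m) (Real.sqrt_nonneg _)
  have hcancel : ((1 : ℝ) / 2) ^ (m + 1) * 2 ^ (m + 1) = 1 := by
    rw [← mul_pow]; norm_num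
  refine ⟨hint, ?_, ?_⟩
  · rw [hval]
    rcases le_total M m with h | h
    · calc min (1 / 768) ((1 / 2) ^ (M + 1)) * (Real.log m / Real.sqrt m)
          ≤ 1 / 768 * (Real.log m / Real.sqrt m) := by
            gcongr
            exact min_le_left _ _
        _ = (1 / 2) ^ (m + 1) * (2 ^ (m + 1) * (1 / 768 * (Real.log m / Real.sqrt m))) := by
            rw [← mul_assoc, hcancel, one_mul]
        _ ≤ _ := by
            gcongr
            exact hM m h
    · calc min (1 / 768) ((1 / 2) ^ (M + 1)) * (Real.log m / Real.sqrt m)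
          ≤ (1 / 2) ^ (M + 1) * 2 := by
            gcongr
            · exact min_le_right _ _
            · exact log_div_sqrt_le_two (by omega)
        _ ≤ (1 / 2) ^ (m + 1) * Real.pi := by
            refine mul_le_mul ?_ Real.two_le_pi zero_le_two (by positivity)
            exact pow_le_pow_of_le_one (by norm_num) (by norm_num) (by omega)
        _ ≤ _ := by
            gcongr
            exact pi_le_integral_patternCount m
  · rw [hval]
    calc (1 / 2) ^ (m + 1) * ∫ x in Set.Ioc 0 Real.pi, (patternCount m x : ℝ)
        ≤ (1 / 2) ^ (m + 1) * (2 ^ (m + 1) * (200 * (Real.log m / Real.sqrt m))) := by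
          gcongr
          exact integral_patternCount_le hm
      _ = _ := by rw [← mul_assoc, hcancel, one_mul]
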